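/- Let $X$ be a compact Riemannian manifold and let $n\in\mathbb{Z}/8$. Define signs $\varepsilon(n),\varepsilon'(n),\varepsilon''(n)\in\{\pm1\}$ by $\varepsilon=(+,+,-,-,-,-,+,+)$ and $\varepsilon'=(+,-,+,+,+,-,+,+)$ for $n=0,\dots,7$, and $\varepsilon''=(+,-,+,-)$ for $n=0,2,4,6$. Let $\mathcal{E}\to X$ be a smooth Hermitian (complex, finite rank) vector bundle with a Clifford action $c:T^*X\to\mathrm{End}(\mathcal{E})$, $c(\xi)^2=-g(\xi,\xi)$, extended to the complex Clifford algebra bundle $\mathbb{C}l(X)$ generated by real covectors with $\xi^2=-g(\xi,\xi)$. If $n$ is even, $\mathcal{E}$ is moreover $\mathbb{Z}/2$-graded by a smooth self-adjoint bundle endomorphism $\gamma$ with $\gamma^2=1$ and $\gamma c(\xi)=-c(\xi)\gamma$; if $n$ is odd no grading is considered. Let $J$ be a smooth antiunitary bundle automorphism of $\mathcal{E}$ making $(\mathcal{E},J)$ a real Clifford module of $KO$-dimension $n$ mod $8$, that is: $J^2=\varepsilon(n)$; $Jc(\omega^*)J^*=c(\tau_{\varepsilon'}(\omega))$ for all $\omega\in\mathbb{C}l(X)$;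 and $J\gamma=\varepsilon''(n)\gamma J$ if $n$ is even. Here $\omega\mapsto\omega^*$ is the conjugate-linear anti-involution and $\tau_{\varepsilon'}$ the complex-linear anti-involution of $\mathbb{C}l(X)$ with $\xi^*=-\xi$ and $\tau_{\varepsilon'}(\xi)=-\varepsilon'(n)\xi$ on real covectors $\xi$. A (symmetric) Dirac-type operator on $\mathcal{E}$ is a first order differential operator $D:C^\infty(X,\mathcal{E})\to C^\infty(X,\mathcal{E})$ that satisfies $[D,f]=c(df)$ for all smooth functions $f$, is symmetric for the $L^2$ inner product given by the Riemannian volume, and is odd for $\gamma$ if $n$ is even. An operator $D$ is called $J$-compatible if $DJ=\varepsilon'JD$. Proposition. Let $D$ be a symmetric Dirac-type operator on $\mathcal{E}$. Then there is a unique symmetric (fibrewise self-adjoint) smooth bundle endomorphism $M$ of $\mathcal{E}$ such that $D-M$ is a $J$-compatible Dirac-type operator and $MJ=-\varepsilon'JM$. Moreover, every symmetric bundle endomorphism $M$ such that $D-M$ is $J$-compatible and $MJ=-\varepsilon'JM$ is given on smooth sections by $M=\tfrac12\,(D-\varepsilon'JDJ^*)$. -/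

import Mathlib

open Bundle
open scoped Manifold ContDiff Bundle TensorProduct ComplexConjugate

noncomputable section

namespace DiracReal

/-! ### Riemannian geometry -/

section Riemannian

variable {d : ℕ} {X : Type*} [TopologicalSpace X] [ChartedSpace (EuclideanSpace ℝ (Fin d)) X]
  [RiemannianBundle (fun x : X => TangentSpace (𝓡 d) x)]

variable (d) in
/-- The cotangent space of `X` at `x`. -/
abbrev Cotangent (x : X) : Type := TangentSpace (𝓡 d) x →L[ℝ] ℝ

instance (x : X) : FiniteDimensional ℝ (TangentSpace (𝓡 d) x) :=
  inferInstanceAs (FiniteDimensional ℝ (EuclideanSpace ℝ (Fin d)))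

instance (x : X) : CompleteSpace (TangentSpace (𝓡 d) x) :=
  FiniteDimensional.complete ℝ _

/-- The musical isomorphism from covectors to vectors: `⟪sharp x ξ, v⟫ = ξ v`. -/
def sharp (x : X) : Cotangent d x →ₗ[ℝ] TangentSpace (𝓡 d) x where
  toFun ξ := (InnerProductSpace.toDual ℝ (TangentSpace (𝓡 d) x)).symm ξ
  map_add' := by simp
  map_smul' := by simp

/-- The metric on the cotangent space, `g(ξ, η) = ⟪ξ♯, η♯⟫`. -/
def cometric (x : X) : LinearMap.BilinForm ℝ (Cotangent d x) :=
  (innerₗ (TangentSpace (𝓡 d) x)).compl₁₂ (sharp x) (sharp x)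

/-- The quadratic form `ξ ↦ -g(ξ, ξ)` on covectors. -/
def cliffordForm (x : X) : QuadraticForm ℝ (Cotangent d x) :=
  -(cometric x).toQuadraticMap

/-- The coordinate vector field `∂/∂xⁱ` of the chart at `x₀`, at the point with coordinates `y`. -/
def coordVector (x₀ : X) (y : EuclideanSpace ℝ (Fin d)) (i : Fin d) :
    TangentSpace (𝓡 d) ((chartAt (EuclideanSpace ℝ (Fin d)) x₀).symm y) :=
  mfderiv (𝓡 d) (𝓡 d) (chartAt (EuclideanSpace ℝ (Fin d)) x₀).symm y
    (EuclideanSpace.single i (1 : ℝ))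

/-- The measure `√(det gᵢⱼ) dx¹ ⋯ dxᵈ` on the domain of the chart at `x₀`, as a measure on `X`. -/
def chartVolume [MeasurableSpace X] (x₀ : X) : MeasureTheory.Measure X :=
  MeasureTheory.Measure.map (chartAt (EuclideanSpace ℝ (Fin d)) x₀).symm
    ((MeasureTheory.volume.restrict
      (chartAt (EuclideanSpace ℝ (Fin d)) x₀).target).withDensity
      (fun y => ENNReal.ofReal (Real.sqrt (Matrix.gram ℝ (coordVector x₀ y)).det)))

variable (d X) in
/-- The Riemannian volume measure of `X`, glued from the chart measures with a smooth partition of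
unity subordinate to the charts (the result does not depend on the partition of unity). -/
def riemannianVolume [IsManifold (𝓡 d) ∞ X] [CompactSpace X] [T2Space X] [MeasurableSpace X] :
    MeasureTheory.Measure X :=
  MeasureTheory.Measure.sum fun x₀ : X =>
    (chartVolume (d := d) x₀).withDensity fun x => ENNReal.ofReal
      ((SmoothPartitionOfUnity.exists_isSubordinate_chartAt_source (𝓡 d) X).choose x₀ x)

end Riemannian

/-! ### The complexified Clifford algebra of the cotangent space -/

section CliffordAlg

variable {d : ℕ} {X : Type*} [TopologicalSpace X] [ChartedSpace (EuclideanSpace ℝ (Fin d)) X]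
  [RiemannianBundle (fun x : X => TangentSpace (𝓡 d) x)]

variable (d) in
/-- The fibre at `x` of the complex Clifford bundle, with relation `ξ² = -g(ξ, ξ)`. -/
abbrev ComplexClifford (x : X) : Type := ℂ ⊗[ℝ] CliffordAlgebra (cliffordForm (d := d) x)

/-- The involution `ω ↦ ω*`: the conjugate-linear anti-automorphism with `ξ* = -ξ` for real
covectors `ξ`. -/
def cliffordStar (x : X) : ComplexClifford d x →ₗ[ℝ] ComplexClifford d x :=
  TensorProduct.map Complex.conjAe.toLinearMap
    (CliffordAlgebra.reverse ∘ₗ CliffordAlgebra.involute.toLinearMap)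

/-- For `e = ±1`, the complex-linear anti-automorphism `τ_e` with `τ_e(ξ) = -e ξ` for real
covectors `ξ`. -/
def cliffordTau (e : ℤ) (x : X) : ComplexClifford d x →ₗ[ℝ] ComplexClifford d x :=
  TensorProduct.map LinearMap.id
    (if e = 1 then CliffordAlgebra.reverse ∘ₗ CliffordAlgebra.involute.toLinearMap
      else CliffordAlgebra.reverse)

end CliffordAlg

/-! ### Smooth sections and bundle maps of a complex vector bundle -/

section Sections

variable (d : ℕ) {X : Type*} [TopologicalSpace X] [ChartedSpace (EuclideanSpace ℝ (Fin d)) X]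
  (F : Type*) [NormedAddCommGroup F] [NormedSpace ℂ F]
  (E : X → Type*) [TopologicalSpace (TotalSpace F E)] [∀ x, NormedAddCommGroup (E x)]
  [∀ x, InnerProductSpace ℂ (E x)] [FiberBundle F E] [VectorBundle ℂ F E]

/-- Multiplying a smooth section by a complex constant gives a smooth section. -/
theorem contMDiff_const_smul (z : ℂ) {s : ∀ x, E x}
    (hs : ContMDiff (𝓡 d) ((𝓡 d).prod 𝓘(ℝ, F)) ∞ (fun x => TotalSpace.mk' F x (s x))) :
    ContMDiff (𝓡 d) ((𝓡 d).prod 𝓘(ℝ, F)) ∞ (fun x => TotalSpace.mk' F x ((z • s) x)) := by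
  intro x₀
  have hs₀ := hs x₀
  rw [Bundle.contMDiffAt_section] at hs₀ ⊢
  have h2 : ContMDiffAt (𝓡 d) 𝓘(ℝ, F) ∞
      (fun x => z • (trivializationAt F E x₀ (TotalSpace.mk' F x (s x))).2) x₀ :=
    (((z • (1 : F →L[ℂ] F)).restrictScalars ℝ).contMDiff.contMDiffAt).comp x₀ hs₀
  refine h2.congr_of_eventuallyEq ?_
  filter_upwards [(trivializationAt F E x₀).open_baseSet.mem_nhds
    (FiberBundle.mem_baseSet_trivializationAt' x₀)] with x hx
  exact ((trivializationAt F E x₀).linear ℂ hx).map_smul z (s x)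

variable [VectorBundle ℝ F E]

/-- The space `C^∞(X, E)` of smooth sections of `E`, as a complex vector space. -/
def Sections : Submodule ℂ (∀ x, E x) where
  carrier := {s | ContMDiff (𝓡 d) ((𝓡 d).prod 𝓘(ℝ, F)) ∞ (fun x => TotalSpace.mk' F x (s x))}
  add_mem' hs ht := ContMDiff.add_section hs ht
  zero_mem' := Bundle.contMDiff_zeroSection ℝ E
  smul_mem' z _ hs := contMDiff_const_smul d F E z hs

/-- The Hermitian metric of `E` is smooth: the pairing of any two smooth sections is smooth. -/
class IsSmoothHermitian : Prop where
  smooth_inner : ∀ s t : Sections d F E,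
    ContMDiff (𝓡 d) 𝓘(ℝ, ℂ) ∞ (fun x => inner ℂ (s.1 x) (t.1 x))

/-- A smooth complex-linear bundle endomorphism of `E`: a family of linear maps of the fibres that
takes smooth sections to smooth sections. -/
structure BundleEnd where
  toFun : ∀ x, E x →ₗ[ℂ] E x
  smooth' : ∀ s ∈ Sections d F E, (fun x => toFun x (s x)) ∈ Sections d F E

/-- An antiunitary bundle automorphism of `E`: a family of conjugate-linear isometric bijections of
the fibres which, like its inverse, takes smooth sections to smooth sections. -/
structure Antiunitary where
  toFun : ∀ x, E x ≃ₗᵢ⋆[ℂ] E x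
  smooth' : ∀ s ∈ Sections d F E, (fun x => toFun x (s x)) ∈ Sections d F E
  smooth_symm' : ∀ s ∈ Sections d F E, (fun x => (toFun x).symm (s x)) ∈ Sections d F E

variable {d F E}

/-- The operator on smooth sections given by a bundle endomorphism. -/
def BundleEnd.op (M : BundleEnd d F E) : Module.End ℂ (Sections d F E) where
  toFun s := ⟨fun x => M.toFun x (s.1 x), M.smooth' s.1 s.2⟩
  map_add' s t := by ext x; simp
  map_smul' z s := by ext x; simp

/-- A bundle endomorphism is symmetric if it is self-adjoint on every fibre. -/
def BundleEnd.IsSymmetric (M : BundleEnd d F E) : Prop := ∀ x, (M.toFun x).IsSymmetric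

/-- The operator on smooth sections given by an antiunitary `J`. -/
def Antiunitary.op (J : Antiunitary d F E) : Sections d F E →ₗ⋆[ℂ] Sections d F E where
  toFun s := ⟨fun x => J.toFun x (s.1 x), J.smooth' s.1 s.2⟩
  map_add' s t := by ext x; simp
  map_smul' z s := by ext x; exact (J.toFun x).map_smulₛₗ z (s.1 x)

/-- The operator on smooth sections given by `J* = J⁻¹`, for an antiunitary `J`. -/
def Antiunitary.opStar (J : Antiunitary d F E) : Sections d F E →ₗ⋆[ℂ] Sections d F E where
  toFun s := ⟨fun x => (J.toFun x).symm (s.1 x), J.smooth_symm' s.1 s.2⟩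
  map_add' s t := by ext x; simp
  map_smul' z s := by ext x; exact (J.toFun x).symm.map_smulₛₗ z (s.1 x)

variable (F E) in
/-- Multiplication of smooth sections by a smooth real function. -/
def mulFn (f : C^∞⟮𝓡 d, X; 𝓘(ℝ, ℝ), ℝ⟯) : Module.End ℂ (Sections d F E) where
  toFun s := ⟨fun x => f x • s.1 x, ContMDiff.smul_section f.contMDiff s.2⟩
  map_add' s t := by ext x; simp
  map_smul' z s := by ext x; exact smul_comm (f x) z (s.1 x)

/-- A complex-linear operator on smooth sections is a differential operator of order at most one:
its iterated commutators with two functions vanish. -/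
def IsFirstOrder (D : Module.End ℂ (Sections d F E)) : Prop :=
  ∀ f g : C^∞⟮𝓡 d, X; 𝓘(ℝ, ℝ), ℝ⟯, ⁅⁅D, mulFn F E f⁆, mulFn F E g⁆ = 0

/-- An operator on smooth sections is symmetric for the `L²` inner product. -/
def IsL2Symmetric [RiemannianBundle (fun x : X => TangentSpace (𝓡 d) x)]
    [IsManifold (𝓡 d) ∞ X] [CompactSpace X] [T2Space X] [MeasurableSpace X]
    (D : Module.End ℂ (Sections d F E)) : Prop :=
  ∀ s t : Sections d F E,
    ∫ x, inner ℂ ((D s).1 x) (t.1 x) ∂(riemannianVolume d X) =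
      ∫ x, inner ℂ (s.1 x) ((D t).1 x) ∂(riemannianVolume d X)

end Sections

/-! ### Real Clifford modules -/

/-- The sign `ε(n)`. -/
def koEps (n : ZMod 8) : ℤ := (![1, 1, -1, -1, -1, -1, 1, 1] : Fin 8 → ℤ) n

/-- The sign `ε'(n)`. -/
def koEps' (n : ZMod 8) : ℤ := (![1, -1, 1, 1, 1, -1, 1, 1] : Fin 8 → ℤ) n

/-- The sign `ε''(n)`; only its values at even `n` matter, it is set to `1` at odd `n`. -/
def koEps'' (n : ZMod 8) : ℤ := (![1, 1, -1, 1, 1, 1, -1, 1] : Fin 8 → ℤ) n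

section Clifford

variable (d : ℕ) {X : Type*} [TopologicalSpace X] [ChartedSpace (EuclideanSpace ℝ (Fin d)) X]
  [RiemannianBundle (fun x : X => TangentSpace (𝓡 d) x)] [IsManifold (𝓡 d) ∞ X]
  (F : Type*) [NormedAddCommGroup F] [NormedSpace ℂ F]
  (E : X → Type*) [TopologicalSpace (TotalSpace F E)] [∀ x, NormedAddCommGroup (E x)]
  [∀ x, InnerProductSpace ℂ (E x)] [FiberBundle F E] [VectorBundle ℂ F E] [VectorBundle ℝ F E]

/-- A smooth Clifford action of the cotangent bundle of `X` on `E`. -/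
structure CliffordAction where
  toFun : ∀ x : X, Cotangent d x →ₗ[ℝ] Module.End ℂ (E x)
  sq : ∀ (x : X) (ξ : Cotangent d x) (v : E x),
    toFun x ξ (toFun x ξ v) = (-(cometric x ξ ξ)) • v
  smooth' : ∀ ξ : ∀ x : X, Cotangent d x,
    ContMDiff (𝓡 d) ((𝓡 d).prod 𝓘(ℝ, EuclideanSpace ℝ (Fin d) →L[ℝ] ℝ)) ∞
      (fun x => TotalSpace.mk' (EuclideanSpace ℝ (Fin d) →L[ℝ] ℝ)
        (E := fun x : X => TangentSpace (𝓡 d) x →L[ℝ] ℝ) x (ξ x)) →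
    ∀ s ∈ Sections d F E, (fun x => toFun x (ξ x) (s x)) ∈ Sections d F E

variable {d F E}

/-- The extension of a Clifford action to the complex Clifford algebra bundle. -/
def CliffordAction.ext (c : CliffordAction d F E) (x : X) :
    ComplexClifford d x →ₐ[ℂ] Module.End ℂ (E x) :=
  Algebra.TensorProduct.lift (Algebra.ofId ℂ (Module.End ℂ (E x)))
    (CliffordAlgebra.lift (cliffordForm (d := d) x) ⟨c.toFun x, by
      intro ξ
      ext v
      rw [Module.End.mul_apply, c.sq, Module.algebraMap_end_apply]
      rfl⟩)
    (fun z _ => Algebra.commutes z _)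

variable (d F E)

/-- A structure of real Clifford module of `KO`-dimension `n mod 8` on `E`. The grading `γ` is part
of the data exactly when `n` is even. -/
structure RealCliffordModule (n : ZMod 8) where
  /-- the Clifford action -/
  c : CliffordAction d F E
  /-- the `ℤ/2`-grading, for even `n` -/
  γ : Even n → BundleEnd d F E
  γ_symmetric : ∀ h, (γ h).IsSymmetric
  γ_sq : ∀ h x v, (γ h).toFun x ((γ h).toFun x v) = v
  γ_odd : ∀ h x ξ v, (γ h).toFun x (c.toFun x ξ v) = -c.toFun x ξ ((γ h).toFun x v)
  /-- the real structure -/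
  J : Antiunitary d F E
  J_sq : ∀ x v, J.toFun x (J.toFun x v) = koEps n • v
  J_clifford : ∀ (x : X) (η : ComplexClifford d x) (v : E x),
    J.toFun x (c.ext x (cliffordStar x η) ((J.toFun x).symm v)) =
      c.ext x (cliffordTau (koEps' n) x η) v
  J_γ : ∀ h x v, J.toFun x ((γ h).toFun x v) = koEps'' n • (γ h).toFun x (J.toFun x v)

variable {d F E}

/-- A (symmetric) Dirac-type operator on a real Clifford module: a first order differential
operator `D`, symmetric on `L²`, with `[D, f] = c(df)` for all smooth `f`, and odd if the module is
graded. By complex linearity, it is enough to consider real functions `f`. -/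
structure IsDiracType [CompactSpace X] [T2Space X] [MeasurableSpace X] {n : ZMod 8}
    (S : RealCliffordModule d F E n) (D : Module.End ℂ (Sections d F E)) : Prop where
  firstOrder : IsFirstOrder D
  commutator : ∀ (f : C^∞⟮𝓡 d, X; 𝓘(ℝ, ℝ), ℝ⟯) (s : Sections d F E) (x : X),
    (⁅D, mulFn F E f⁆ s).1 x = S.c.toFun x (mvfderiv (𝓡 d) f x) (s.1 x)
  symmetric : IsL2Symmetric D
  odd : ∀ h s, D ((S.γ h).op s) = -(S.γ h).op (D s)

/-- An operator `D` on a real Clifford module is `J`-compatible if `D J = ε' J D`. -/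
def IsJCompatible {n : ZMod 8} (S : RealCliffordModule d F E n)
    (D : Module.End ℂ (Sections d F E)) : Prop :=
  ∀ s, D (S.J.op s) = koEps' n • S.J.op (D s)

/-- The relation `M J = -ε' J M` for a bundle endomorphism `M` of a real Clifford module. -/
def JAnticommutes {n : ZMod 8} (S : RealCliffordModule d F E n) (M : BundleEnd d F E) : Prop :=
  ∀ x v, M.toFun x (S.J.toFun x v) = -(koEps' n • S.J.toFun x (M.toFun x v))

end Clifford

end DiracReal

end

open scoped Manifold ContDiff Bundle
open Bundle DiracReal

noncomputable section

namespace DiracReal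

/-! ### Tensorial operators on smooth sections -/

section Tensorial

variable {d : ℕ} {X : Type*} [TopologicalSpace X] [ChartedSpace (EuclideanSpace ℝ (Fin d)) X]
  {F : Type*} [NormedAddCommGroup F] [NormedSpace ℂ F]
  {E : X → Type*} [TopologicalSpace (TotalSpace F E)] [∀ x, NormedAddCommGroup (E x)]
  [∀ x, InnerProductSpace ℂ (E x)] [FiberBundle F E] [VectorBundle ℂ F E] [VectorBundle ℝ F E]

/-! Since `J² = ±1` and `ε'² = 1`, the map `D ↦ ε' J D J*` is an involution on operators. Its fixed
points are the `J`-compatible operators, and `M J = -ε' J M` describes its `-1` eigenspace. Hence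
`M` can only be the `-1` part `½ (D - ε' J D J*)` of `D`, which gives uniqueness and the formula
(`op_eq_antiPart`).

For existence, this part must come from a symmetric bundle endomorphism. The Clifford relation on
covectors reads `J c(ξ) J* = ε' c(ξ)`, so `D` and `ε' J D J*` have the same commutator `c(df)` with
every real function `f`. Their difference commutes with functions (`antiPart_mulFn`) and is
therefore tensorial (`exists_bundleEnd_op_eq`).

As `J` is antiunitary, `J D J*` is `L²`-symmetric along with `D`. Testing against functions turns
`L²` symmetry of a bundle endomorphism into fibrewise self-adjointness
(`BundleEnd.isSymmetric_of_isL2Symmetric`); this needs a volume measure that is finite and positive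
on nonempty open sets. Oddness survives because the sign `ε''` enters `J D J*` twice. Subtracting a
symmetric odd endomorphism then keeps `D` of Dirac type (`IsDiracType.sub_op`). -/

theorem smul_mem_sections {ψ : C^∞⟮𝓡 d, X; 𝓘(ℝ, ℝ), ℝ⟯} {u : Set X} (hu : IsOpen u)
    (hψ : tsupport ψ ⊆ u) {s : ∀ x, E x}
    (hs : ContMDiffOn (𝓡 d) ((𝓡 d).prod 𝓘(ℝ, F)) ∞ (fun x => TotalSpace.mk' F x (s x)) u) :
    (fun x => ψ x • s x) ∈ Sections d F E :=
  ContMDiffOn.smul_section_of_tsupport ψ.contMDiff.contMDiffOn hu hψ hs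

variable [IsManifold (𝓡 d) ∞ X] [T2Space X]

/-- Every neighbourhood of a point contains the support of a bump function at that point. -/
theorem exists_bump {x : X} {u : Set X} (hu : u ∈ nhds x) :
    ∃ ψ : C^∞⟮𝓡 d, X; 𝓘(ℝ, ℝ), ℝ⟯, ψ x = 1 ∧ tsupport ψ ⊆ u := by
  obtain ⟨f, -, hf⟩ := (SmoothBumpFunction.nhds_basis_tsupport (I := 𝓡 d) x).mem_iff.1 hu
  exact ⟨⟨f, f.contMDiff⟩, f.eq_one, hf⟩

variable [ContMDiffVectorBundle ∞ F E (𝓡 d)]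

/-- A local extension of `v` is cut off by a bump function. Through this, identities between
operators on sections descend to the fibres. -/
theorem exists_section_eq (x : X) (v : E x) : ∃ s : Sections d F E, s.1 x = v := by
  obtain ⟨u, hu, hs⟩ := FiberBundle.exists_contMDiffOn_extend (𝕜 := ℝ) (k := ∞) (𝓡 d) F v
  obtain ⟨o, hou, ho, hxo⟩ := mem_nhds_iff.1 hu
  obtain ⟨ψ, hψx, hψ⟩ := exists_bump (d := d) (ho.mem_nhds hxo)
  refine ⟨⟨_, smul_mem_sections ho hψ (hs.mono hou)⟩, ?_⟩
  simp [hψx]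

theorem BundleEnd.op_injective :
    Function.Injective (BundleEnd.op : BundleEnd d F E → Module.End ℂ (Sections d F E)) := by
  intro M N h
  obtain ⟨M, hM⟩ := M
  obtain ⟨N, hN⟩ := N
  congr
  ext x v
  obtain ⟨s, rfl⟩ := exists_section_eq (d := d) (F := F) (E := E) x v
  exact congrArg (fun T : Module.End ℂ (Sections d F E) => (T s).1 x) h

variable [FiniteDimensional ℂ F]

/-- A section that vanishes at `x` becomes, after multiplication by a function which is `1` at `x`,
a combination of sections with coefficients that vanish at `x`. -/
theorem exists_mulFn_eq_sum (s : Sections d F E) (x : X) (hs : s.1 x = 0) :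
    ∃ (m : ℕ) (φ : C^∞⟮𝓡 d, X; 𝓘(ℝ, ℝ), ℝ⟯) (f : Fin m → C^∞⟮𝓡 d, X; 𝓘(ℝ, ℝ), ℝ⟯)
      (t : Fin m → Sections d F E),
      φ x = 1 ∧ (∀ i, f i x = 0) ∧ mulFn F E φ s = ∑ i, mulFn F E (f i) (t i) := by
  have : FiniteDimensional ℝ F := FiniteDimensional.complexToReal F
  have : ContMDiffVectorBundle 1 F E (𝓡 d) :=
    ContMDiffVectorBundle.of_le (n := ∞) (by exact_mod_cast le_top)
  let e := trivializationAt F E x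
  have hxe : x ∈ e.baseSet := FiberBundle.mem_baseSet_trivializationAt F E x
  -- A real basis, because the coefficients are to be real-valued functions.
  let b := Module.finBasis ℝ F
  obtain ⟨ψ, hψx, hψ⟩ := exists_bump (d := d) (e.open_baseSet.mem_nhds hxe)
  have hc : ∀ i, ContMDiff (𝓡 d) 𝓘(ℝ, ℝ) ∞
      (fun y => ψ y • e.localFrameCoeff (𝓡 d) b i y (s.1 y)) := fun i =>
    contMDiff_of_tsupport fun y hy => by
      have hy' : y ∈ e.baseSet := hψ (tsupport_smul_subset_left _ _ hy)
      exact ψ.contMDiff.contMDiffAt.smul (contMDiffAt_localFrameCoeff b hy' (s.2 y) i)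
  -- One factor `ψ` makes the frame coefficients global, the other the frame sections.
  refine ⟨_, ψ * ψ, fun i => ⟨_, hc i⟩, fun i => ⟨_, smul_mem_sections e.open_baseSet hψ
    (e.contMDiffOn_localFrame_baseSet ∞ b i)⟩, by simp [hψx], fun i => ?_, ?_⟩
  · change ψ x • e.localFrameCoeff (𝓡 d) b i x (s.1 x) = 0
    simp [hs]
  · ext y
    rw [AddSubmonoidClass.coe_finsetSum, Finset.sum_apply]
    change (ψ y * ψ y) • s.1 y =
      ∑ i, (ψ y • e.localFrameCoeff (𝓡 d) b i y (s.1 y)) • ψ y • e.localFrame b i y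
    by_cases hy : y ∈ e.baseSet
    · conv_lhs => rw [e.eq_sum_localFrameCoeff_smul (I := 𝓡 d) (b := b) (s := s.1) hy]
      rw [Finset.smul_sum]
      refine Finset.sum_congr rfl fun i _ => ?_
      simp only [smul_smul, smul_eq_mul]
      congr 1
      ring
    · have : ψ y = 0 := image_eq_zero_of_notMem_tsupport fun h => hy (hψ h)
      simp [this]

/-- An operator that commutes with multiplication by functions is tensorial. -/
theorem apply_eq_zero_of_commute {T : Module.End ℂ (Sections d F E)}
    (hT : ∀ f s, T (mulFn F E f s) = mulFn F E f (T s)) {s : Sections d F E} {x : X}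
    (hs : s.1 x = 0) : (T s).1 x = 0 := by
  obtain ⟨m, φ, f, t, hφ, hf, h⟩ := exists_mulFn_eq_sum s x hs
  have h' := congrArg (fun r => (T r).1 x) h
  simp only [map_sum, hT] at h'
  rw [AddSubmonoidClass.coe_finsetSum, Finset.sum_apply] at h'
  change φ x • (T s).1 x = ∑ i, f i x • (T (t i)).1 x at h'
  simpa [hφ, hf] using h'

theorem apply_congr_of_commute {T : Module.End ℂ (Sections d F E)}
    (hT : ∀ f s, T (mulFn F E f s) = mulFn F E f (T s)) {s t : Sections d F E} {x : X}
    (hst : s.1 x = t.1 x) : (T s).1 x = (T t).1 x := by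
  have := apply_eq_zero_of_commute hT (s := s - t) (x := x) (sub_eq_zero.2 hst)
  rw [map_sub] at this
  exact sub_eq_zero.1 this

/-- An operator that commutes with multiplication by functions is a bundle endomorphism. -/
theorem exists_bundleEnd_op_eq {T : Module.End ℂ (Sections d F E)}
    (hT : ∀ f s, T (mulFn F E f s) = mulFn F E f (T s)) : ∃ M : BundleEnd d F E, M.op = T := by
  -- The chosen extensions `σ x v` need not be linear in `v`; tensoriality makes `(T (σ x v)).1 x`
  -- independent of the choice.
  choose σ hσ using fun x => exists_section_eq (d := d) (F := F) (E := E) x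
  have key (s : Sections d F E) (x : X) : (T (σ x (s.1 x))).1 x = (T s).1 x :=
    apply_congr_of_commute hT (hσ x _)
  refine ⟨⟨fun x => { toFun := fun v => (T (σ x v)).1 x
                      map_add' := fun v w => ?_
                      map_smul' := fun z v => ?_ }, fun s hs => ?_⟩, ?_⟩
  · rw [apply_congr_of_commute hT (t := σ x v + σ x w), map_add]
    · rfl
    · rw [hσ]
      change _ = (σ x v).1 x + (σ x w).1 x
      rw [hσ, hσ]
  · rw [apply_congr_of_commute hT (t := z • σ x v), map_smul]
    · rfl
    · rw [hσ]
      change _ = z • (σ x v).1 x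
      rw [hσ]
  · convert (T ⟨s, hs⟩).2 using 1
    exact funext fun x => key ⟨s, hs⟩ x
  · ext s x
    exact key s x

end Tensorial

end DiracReal

namespace DiracReal

/-! ### The Riemannian volume measure -/

section Volume

open MeasureTheory

variable {d : ℕ} {X : Type*} [TopologicalSpace X] [ChartedSpace (EuclideanSpace ℝ (Fin d)) X]

section

variable [IsManifold (𝓡 d) ∞ X]

theorem linearIndependent_coordVector (x₀ : X) {y : EuclideanSpace ℝ (Fin d)}
    (hy : y ∈ (chartAt (EuclideanSpace ℝ (Fin d)) x₀).target) :
    LinearIndependent ℝ (coordVector x₀ y) := by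
  have : IsManifold (𝓡 d) 1 X := IsManifold.of_le (n := ∞) (by exact_mod_cast le_top)
  have hinj := (mdifferentiable_chart (I := 𝓡 d) x₀).symm.mfderiv_injective (x := y) hy
  have hli := (EuclideanSpace.basisFun (Fin d) ℝ).toBasis.linearIndependent
  convert hli.map' (mfderiv (𝓡 d) (𝓡 d) (chartAt (EuclideanSpace ℝ (Fin d)) x₀).symm y).toLinearMap
    (LinearMap.ker_eq_bot.2 hinj) using 1
  · ext i : 1
    simp [coordVector]
    rfl
  · rfl

/-- The coordinate field is the tangent map of the inverse chart applied to a constant field. -/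
theorem continuousOn_coordVector (x₀ : X) (i : Fin d) :
    ContinuousOn (fun y => (TotalSpace.mk' (EuclideanSpace ℝ (Fin d))
      (E := fun x : X => TangentSpace (𝓡 d) x) _ (coordVector x₀ y i)))
      (chartAt (EuclideanSpace ℝ (Fin d)) x₀).target := by
  have : IsManifold (𝓡 d) 1 X := IsManifold.of_le (n := ∞) (by exact_mod_cast le_top)
  have h := (contMDiffOn_chart_symm (I := 𝓡 d) (n := 1) (x := x₀)).continuousOn_tangentMapWithin
    le_rfl (chartAt (EuclideanSpace ℝ (Fin d)) x₀).open_target.uniqueMDiffOn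
  have hc : Continuous fun y : EuclideanSpace ℝ (Fin d) =>
      (TotalSpace.mk y (EuclideanSpace.single i (1 : ℝ)) :
        TangentBundle (𝓡 d) (EuclideanSpace ℝ (Fin d))) :=
    (tangentBundleModelSpaceHomeomorph (𝓡 d)).symm.continuous.comp
      (continuous_id.prodMk continuous_const)
  refine (h.comp hc.continuousOn fun y hy => hy).congr fun y hy => ?_
  have hm := mfderivWithin_of_mem_nhds (I := 𝓡 d) (I' := 𝓡 d)
    (f := (chartAt (EuclideanSpace ℝ (Fin d)) x₀).symm)
    ((chartAt (EuclideanSpace ℝ (Fin d)) x₀).open_target.mem_nhds hy)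
  change _ = TotalSpace.mk' _ _ (mfderivWithin (𝓡 d) (𝓡 d)
    (chartAt (EuclideanSpace ℝ (Fin d)) x₀).symm (chartAt (EuclideanSpace ℝ (Fin d)) x₀).target y _)
  rw [hm]
  rfl

end

variable [RiemannianBundle (fun x : X => TangentSpace (𝓡 d) x)]

/-- The density of the Riemannian volume in the chart at `x₀`. -/
def chartDensity (x₀ : X) (y : EuclideanSpace ℝ (Fin d)) : ℝ :=
  Real.sqrt (Matrix.gram ℝ (coordVector x₀ y)).det

section

variable [IsManifold (𝓡 d) ∞ X]

theorem chartDensity_pos (x₀ : X) {y : EuclideanSpace ℝ (Fin d)}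
    (hy : y ∈ (chartAt (EuclideanSpace ℝ (Fin d)) x₀).target) : 0 < chartDensity x₀ y := by
  have h₀ := (Matrix.posSemidef_gram ℝ (coordVector x₀ y)).det_nonneg
  have h := (Matrix.det_gram_ne_zero_iff_linearIndependent (𝕜 := ℝ) (v := coordVector x₀ y)).2
    (linearIndependent_coordVector x₀ hy)
  exact Real.sqrt_pos.2 (lt_of_le_of_ne h₀ h.symm)

variable [IsContMDiffRiemannianBundle (𝓡 d) ∞ (EuclideanSpace ℝ (Fin d))
      (fun x : X => TangentSpace (𝓡 d) x)]

theorem continuousOn_chartDensity (x₀ : X) :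
    ContinuousOn (chartDensity x₀) (chartAt (EuclideanSpace ℝ (Fin d)) x₀).target := by
  have : IsManifold (𝓡 d) 1 X := IsManifold.of_le (n := ∞) (by exact_mod_cast le_top)
  have : IsContinuousRiemannianBundle (EuclideanSpace ℝ (Fin d))
      (fun x : X => TangentSpace (𝓡 d) x) := by
    obtain ⟨g, hg, h⟩ := IsContMDiffRiemannianBundle.exists_contMDiff (IB := 𝓡 d) (n := ∞)
      (F := EuclideanSpace ℝ (Fin d)) (E := fun x : X => TangentSpace (𝓡 d) x)
    exact ⟨g, hg.continuous, h⟩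
  refine Real.continuous_sqrt.comp_continuousOn ?_
  refine (Continuous.matrix_det continuous_id).comp_continuousOn
    (continuousOn_pi.2 fun i => continuousOn_pi.2 fun j => ?_)
  exact ContinuousOn.inner_bundle (continuousOn_coordVector x₀ i) (continuousOn_coordVector x₀ j)

end

variable [MeasurableSpace X] [BorelSpace X]

theorem aemeasurable_chart_symm (x₀ : X) :
    AEMeasurable (chartAt (EuclideanSpace ℝ (Fin d)) x₀).symm
      ((volume.restrict (chartAt (EuclideanSpace ℝ (Fin d)) x₀).target).withDensity
        (fun y => ENNReal.ofReal (chartDensity x₀ y))) :=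
  ((chartAt (EuclideanSpace ℝ (Fin d)) x₀).continuousOn_symm.aemeasurable
    (chartAt (EuclideanSpace ℝ (Fin d)) x₀).open_target.measurableSet).mono_ac
      (withDensity_absolutelyContinuous _ _)

theorem chartVolume_apply (x₀ : X) {s : Set X} (hs : MeasurableSet s) :
    chartVolume (d := d) x₀ s =
      ((volume.restrict (chartAt (EuclideanSpace ℝ (Fin d)) x₀).target).withDensity
        (fun y => ENNReal.ofReal (chartDensity x₀ y)))
        ((chartAt (EuclideanSpace ℝ (Fin d)) x₀).symm ⁻¹' s) :=
  Measure.map_apply_of_aemeasurable (aemeasurable_chart_symm x₀) hs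

variable [IsManifold (𝓡 d) ∞ X]
  [IsContMDiffRiemannianBundle (𝓡 d) ∞ (EuclideanSpace ℝ (Fin d))
      (fun x : X => TangentSpace (𝓡 d) x)]

theorem chartVolume_lt_top_of_isCompact [T2Space X] (x₀ : X) {K : Set X} (hK : IsCompact K)
    (hKs : K ⊆ (chartAt (EuclideanSpace ℝ (Fin d)) x₀).source) :
    chartVolume (d := d) x₀ K < ⊤ := by
  rw [chartVolume_apply x₀ hK.measurableSet, withDensity_apply' _ _,
    Measure.restrict_restrict' (chartAt (EuclideanSpace ℝ (Fin d)) x₀).open_target.measurableSet]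
  set e := chartAt (EuclideanSpace ℝ (Fin d)) x₀
  have hsub : e '' K ⊆ e.target := by
    rintro _ ⟨x, hx, rfl⟩
    exact e.map_source (hKs hx)
  have hset : e.symm ⁻¹' K ∩ e.target ⊆ e '' K := fun y hy => ⟨_, hy.1, e.right_inv hy.2⟩
  refine (lintegral_mono_set hset).trans_lt ?_
  exact (((continuousOn_chartDensity x₀).mono hsub).integrableOn_compact
    (hK.image_of_continuousOn (e.continuousOn.mono hKs))).lintegral_lt_top

/-- The density is strictly positive on the chart target, so a null set for the chart volume would
give a nonempty open set of Lebesgue measure zero. -/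
theorem chartVolume_ne_zero_of_isOpen (x₀ : X) {u : Set X} (hu : IsOpen u)
    (hus : u ⊆ (chartAt (EuclideanSpace ℝ (Fin d)) x₀).source) (hne : u.Nonempty) :
    chartVolume (d := d) x₀ u ≠ 0 := by
  intro h
  set e := chartAt (EuclideanSpace ℝ (Fin d)) x₀ with he
  have hm : AEMeasurable (fun y => ENNReal.ofReal (chartDensity x₀ y))
      (volume.restrict e.target) :=
    ((continuousOn_chartDensity x₀).aemeasurable e.open_target.measurableSet).ennreal_ofReal
  rw [chartVolume_apply x₀ hu.measurableSet, withDensity_apply_eq_zero' hm,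
    Measure.restrict_apply' e.open_target.measurableSet] at h
  refine (e.isOpen_inter_preimage_symm hu).measure_ne_zero volume ?_ (measure_mono_null ?_ h)
  · obtain ⟨x, hx⟩ := hne
    exact ⟨e x, e.map_source (hus hx), by simpa [e.left_inv (hus hx)] using hx⟩
  · exact fun y hy => ⟨⟨(ENNReal.ofReal_pos.2 (chartDensity_pos x₀ hy.1)).ne', hy.2⟩, hy.1⟩

variable [CompactSpace X] [T2Space X]

/-- By compactness only finitely many members of the partition of unity are nonzero. Each is at most
`1` with compact support inside its chart, where the volume is finite. -/
instance isFiniteMeasure_riemannianVolume : IsFiniteMeasure (riemannianVolume d X) := by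
  let ρ := (SmoothPartitionOfUnity.exists_isSubordinate_chartAt_source (𝓡 d) X).choose
  have hρ : ρ.IsSubordinate _ :=
    (SmoothPartitionOfUnity.exists_isSubordinate_chartAt_source (𝓡 d) X).choose_spec
  have hfin := ρ.locallyFinite.finite_nonempty_of_compact
  constructor
  rw [riemannianVolume, Measure.sum_apply _ MeasurableSet.univ,
    tsum_eq_sum (s := hfin.toFinset) fun x₀ hx₀ => ?_]
  · refine ENNReal.sum_lt_top.2 fun x₀ _ => ?_
    rw [withDensity_apply _ MeasurableSet.univ, Measure.restrict_univ]
    calc ∫⁻ x, ENNReal.ofReal (ρ x₀ x) ∂chartVolume (d := d) x₀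
        ≤ ∫⁻ x, (tsupport (ρ x₀)).indicator (fun _ => 1) x ∂chartVolume (d := d) x₀ := by
          refine lintegral_mono fun x => ?_
          by_cases hx : x ∈ tsupport (ρ x₀)
          · simpa [hx] using ρ.le_one x₀ x
          · simp [image_eq_zero_of_notMem_tsupport hx]
      _ = chartVolume (d := d) x₀ (tsupport (ρ x₀)) := by
          rw [lintegral_indicator (isClosed_tsupport _).measurableSet]
          simp
      _ < ⊤ := chartVolume_lt_top_of_isCompact x₀ (isClosed_tsupport _).isCompact (hρ x₀)
  · have hx : ∀ x, ρ x₀ x = 0 := by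
      simpa [Set.not_nonempty_iff_eq_empty, Function.support_eq_empty_iff, funext_iff] using hx₀
    change (chartVolume (d := d) x₀).withDensity (fun x => ENNReal.ofReal (ρ x₀ x)) _ = 0
    simp [hx]

instance isOpenPosMeasure_riemannianVolume : (riemannianVolume d X).IsOpenPosMeasure := by
  let ρ := (SmoothPartitionOfUnity.exists_isSubordinate_chartAt_source (𝓡 d) X).choose
  have hρ : ρ.IsSubordinate _ :=
    (SmoothPartitionOfUnity.exists_isSubordinate_chartAt_source (𝓡 d) X).choose_spec
  refine ⟨fun u hu ⟨x, hx⟩ h => ?_⟩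
  -- A single summand suffices: `u` meets the open set `ρ x₀ > 0`, which lies in the chart at `x₀`.
  obtain ⟨x₀, hx₀⟩ := ρ.exists_pos_of_mem (Set.mem_univ x)
  rw [riemannianVolume, Measure.sum_apply _ hu.measurableSet, ENNReal.tsum_eq_zero] at h
  have h₀ : (chartVolume (d := d) x₀).withDensity (fun x => ENNReal.ofReal (ρ x₀ x)) u = 0 := h x₀
  have hc : Continuous (ρ x₀) := (ρ x₀).contMDiff.continuous
  rw [withDensity_apply_eq_zero' hc.measurable.ennreal_ofReal.aemeasurable] at h₀
  refine chartVolume_ne_zero_of_isOpen x₀ ((isOpen_lt continuous_const hc).inter hu)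
    (fun y hy => hρ x₀ (subset_tsupport _ (ne_of_gt hy.1))) ⟨x, hx₀, hx⟩ (measure_mono_null ?_ h₀)
  exact fun y hy => ⟨(ENNReal.ofReal_pos.2 hy.1).ne', hy.2⟩

end Volume

end DiracReal

namespace DiracReal

/-! ### Symmetric operators -/

section Symmetric

open MeasureTheory

/-- A conjugate-linear isometry exchanges the two arguments of the inner product. -/
theorem inner_map_map_of_antiunitary {V : Type*} [NormedAddCommGroup V] [InnerProductSpace ℂ V]
    (J : V ≃ₗᵢ⋆[ℂ] V) (v w : V) : inner ℂ (J v) (J w) = inner ℂ w v := by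
  -- In the polarization identity `J` preserves all norms but turns `i` into `-i`, so the inner
  -- product gets conjugated.
  have hI : Complex.I • J w = -J (Complex.I • w) := by
    rw [J.map_smulₛₗ]
    simp
  rw [← inner_conj_symm w v, inner_eq_sum_norm_sq_div_four, inner_eq_sum_norm_sq_div_four v w]
  simp only [RCLike.I_to_complex, hI, sub_neg_eq_add, ← sub_eq_add_neg, ← map_add, ← map_sub,
    J.norm_map]
  have h4 : (starRingEnd ℂ) 4 = 4 := map_ofNat _ 4
  simp [h4]
  ring

theorem inner_map_eq_inner_symm {V : Type*} [NormedAddCommGroup V] [InnerProductSpace ℂ V]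
    (J : V ≃ₗᵢ⋆[ℂ] V) (v w : V) : inner ℂ (J v) w = inner ℂ (J.symm w) v := by
  conv_lhs => rw [← J.apply_symm_apply w]
  exact inner_map_map_of_antiunitary J v (J.symm w)

variable {d : ℕ} {X : Type*} [TopologicalSpace X] [ChartedSpace (EuclideanSpace ℝ (Fin d)) X]
  {F : Type*} [NormedAddCommGroup F] [NormedSpace ℂ F]
  {E : X → Type*} [TopologicalSpace (TotalSpace F E)] [∀ x, NormedAddCommGroup (E x)]
  [∀ x, InnerProductSpace ℂ (E x)] [FiberBundle F E] [VectorBundle ℂ F E] [VectorBundle ℝ F E]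

theorem continuous_inner_sections [IsSmoothHermitian d F E] (s t : Sections d F E) :
    Continuous fun x => inner ℂ (s.1 x) (t.1 x) :=
  (IsSmoothHermitian.smooth_inner s t).continuous

variable [RiemannianBundle (fun x : X => TangentSpace (𝓡 d) x)]
  [IsManifold (𝓡 d) ∞ X] [CompactSpace X] [T2Space X] [MeasurableSpace X]

theorem IsL2Symmetric.smul {T : Module.End ℂ (Sections d F E)} (hT : IsL2Symmetric T) (r : ℝ) :
    IsL2Symmetric ((r : ℂ) • T) := by
  intro s t
  change ∫ x, inner ℂ ((r : ℂ) • (T s).1 x) (t.1 x) ∂riemannianVolume d X =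
    ∫ x, inner ℂ (s.1 x) ((r : ℂ) • (T t).1 x) ∂riemannianVolume d X
  simp only [inner_smul_left, inner_smul_right, Complex.conj_ofReal, integral_const_mul, hT s t]

/-- The conjugate `J D J*` of a symmetric operator by an antiunitary is symmetric. -/
theorem IsL2Symmetric.conj {T T' : Module.End ℂ (Sections d F E)} (hT : IsL2Symmetric T)
    (J : Antiunitary d F E) (h : ∀ s, T' s = J.op (T (J.opStar s))) : IsL2Symmetric T' := by
  intro s t
  rw [h, h]
  -- Moving `J` across the inner product swaps its arguments, so the symmetry of `T` is applied to
  -- `J* t` and `J* s` in this order.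
  refine Eq.trans ?_ ((hT (J.opStar t) (J.opStar s)).symm.trans ?_)
  · exact integral_congr_ae (.of_forall fun x => inner_map_eq_inner_symm (J.toFun x) _ _)
  · refine integral_congr_ae (.of_forall fun x => ?_)
    have := inner_map_eq_inner_symm (J.toFun x).symm (s.1 x) ((T (J.opStar t)).1 x)
    refine ((inner_conj_symm _ _).symm.trans ?_)
    exact (congrArg _ this).trans (inner_conj_symm _ _)

theorem BundleEnd.IsSymmetric.isL2Symmetric {M : BundleEnd d F E} (hM : M.IsSymmetric) :
    IsL2Symmetric M.op :=
  fun _ _ => integral_congr_ae (.of_forall fun x => hM x _ _)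

variable [BorelSpace X]
  [IsContMDiffRiemannianBundle (𝓡 d) ∞ (EuclideanSpace ℝ (Fin d))
      (fun x : X => TangentSpace (𝓡 d) x)]
  [IsSmoothHermitian d F E]

theorem integrable_inner_sections (s t : Sections d F E) :
    Integrable (fun x => inner ℂ (s.1 x) (t.1 x)) (riemannianVolume d X) :=
  (continuous_inner_sections s t).integrable_of_hasCompactSupport (.of_compactSpace _)

theorem IsL2Symmetric.sub {T T' : Module.End ℂ (Sections d F E)} (hT : IsL2Symmetric T)
    (hT' : IsL2Symmetric T') : IsL2Symmetric (T - T') := by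
  intro s t
  change ∫ x, inner ℂ ((T s).1 x - (T' s).1 x) (t.1 x) ∂riemannianVolume d X =
    ∫ x, inner ℂ (s.1 x) ((T t).1 x - (T' t).1 x) ∂riemannianVolume d X
  simp only [inner_sub_left, inner_sub_right]
  rw [integral_sub (integrable_inner_sections _ _) (integrable_inner_sections _ _),
    integral_sub (integrable_inner_sections _ _) (integrable_inner_sections _ _), hT s t, hT' s t]

variable [ContMDiffVectorBundle ∞ F E (𝓡 d)]

/-- A bundle endomorphism that is symmetric on `L²` is self-adjoint on every fibre. -/
theorem BundleEnd.isSymmetric_of_isL2Symmetric {M : BundleEnd d F E} (hM : IsL2Symmetric M.op) :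
    M.IsSymmetric := by
  intro x v w
  obtain ⟨s, rfl⟩ := exists_section_eq (d := d) (F := F) (E := E) x v
  obtain ⟨t, rfl⟩ := exists_section_eq (d := d) (F := F) (E := E) x w
  have hc₁ := continuous_inner_sections (M.op s) t
  have hc₂ := continuous_inner_sections s (M.op t)
  have hi₁ := integrable_inner_sections (M.op s) t
  have hi₂ := integrable_inner_sections s (M.op t)
  have h₀ : (fun y => inner ℂ ((M.op s).1 y) (t.1 y) - inner ℂ (s.1 y) ((M.op t).1 y))
      =ᵐ[riemannianVolume d X] fun _ => (0 : ℂ) := by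
    -- A test function `g` is absorbed into `s`, since `M` is linear on fibres; symmetry for `g s`
    -- and `t` then makes the integral vanish.
    refine ae_eq_zero_of_integral_contMDiff_smul_eq_zero (𝓡 d) (hi₁.sub hi₂).locallyIntegrable
      fun g hg _ => ?_
    let f : C^∞⟮𝓡 d, X; 𝓘(ℝ, ℝ), ℝ⟯ := ⟨g, hg⟩
    have hf₁ : ∀ y, g y • inner ℂ ((M.op s).1 y) (t.1 y) =
        inner ℂ ((M.op (mulFn F E f s)).1 y) (t.1 y) := fun y => by
      change _ = inner ℂ (M.toFun y (g y • s.1 y)) (t.1 y)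
      rw [← Complex.coe_smul (g y) (s.1 y), map_smul, inner_smul_left, Complex.conj_ofReal]
      rfl
    have hf₂ : ∀ y, g y • inner ℂ (s.1 y) ((M.op t).1 y) =
        inner ℂ ((mulFn F E f s).1 y) ((M.op t).1 y) := fun y => by
      change _ = inner ℂ (g y • s.1 y) _
      rw [← Complex.coe_smul (g y) (s.1 y), inner_smul_left, Complex.conj_ofReal]
      rfl
    simp only [smul_sub, hf₁, hf₂]
    rw [integral_sub (integrable_inner_sections _ _) (integrable_inner_sections _ _), sub_eq_zero]
    exact hM _ _
  -- Continuous functions that agree almost everywhere agree everywhere, as the volume charges every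
  -- nonempty open set.
  have h := ((hc₁.sub hc₂).ae_eq_iff_eq _ continuous_const).1 h₀
  exact sub_eq_zero.1 (congrFun h x)

end Symmetric

end DiracReal

namespace DiracReal

/-! ### Real structures and Dirac-type operators -/

theorem koEps_mul_self (n : ZMod 8) : koEps n * koEps n = 1 := by
  revert n; decide

theorem koEps'_mul_self (n : ZMod 8) : koEps' n * koEps' n = 1 := by
  revert n; decide

theorem koEps''_mul_self (n : ZMod 8) : koEps'' n * koEps'' n = 1 := by
  revert n; decide

section Antiunitary

variable {d : ℕ} {X : Type*} [TopologicalSpace X] [ChartedSpace (EuclideanSpace ℝ (Fin d)) X]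
  {F : Type*} [NormedAddCommGroup F] [NormedSpace ℂ F]
  {E : X → Type*} [TopologicalSpace (TotalSpace F E)] [∀ x, NormedAddCommGroup (E x)]
  [∀ x, InnerProductSpace ℂ (E x)] [FiberBundle F E] [VectorBundle ℂ F E] [VectorBundle ℝ F E]

theorem Antiunitary.op_opStar (J : Antiunitary d F E) (s : Sections d F E) :
    J.op (J.opStar s) = s :=
  Subtype.ext (funext fun x => (J.toFun x).apply_symm_apply _)

theorem Antiunitary.opStar_op (J : Antiunitary d F E) (s : Sections d F E) :
    J.opStar (J.op s) = s :=
  Subtype.ext (funext fun x => (J.toFun x).symm_apply_apply _)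

theorem Antiunitary.map_real_smul (J : Antiunitary d F E) (x : X) (r : ℝ) (v : E x) :
    J.toFun x (r • v) = r • J.toFun x v := by
  rw [← Complex.coe_smul, (J.toFun x).map_smulₛₗ, Complex.conj_ofReal, Complex.coe_smul]

theorem Antiunitary.opStar_mulFn (J : Antiunitary d F E) (f : C^∞⟮𝓡 d, X; 𝓘(ℝ, ℝ), ℝ⟯)
    (s : Sections d F E) : J.opStar (mulFn F E f s) = mulFn F E f (J.opStar s) := by
  refine Subtype.ext (funext fun x => (J.toFun x).injective ?_)
  change J.toFun x ((J.toFun x).symm (f x • s.1 x)) = J.toFun x (f x • (J.toFun x).symm (s.1 x))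
  rw [J.map_real_smul]
  simp

/-- The conjugate `J D J*` of an operator by an antiunitary. -/
def Antiunitary.conj (J : Antiunitary d F E) (D : Module.End ℂ (Sections d F E)) :
    Module.End ℂ (Sections d F E) :=
  (J.op ∘ₛₗ D) ∘ₛₗ J.opStar

theorem Antiunitary.conj_apply (J : Antiunitary d F E) (D : Module.End ℂ (Sections d F E))
    (s : Sections d F E) : J.conj D s = J.op (D (J.opStar s)) :=
  rfl

end Antiunitary

section Dirac

variable {d : ℕ} {X : Type*} [TopologicalSpace X] [ChartedSpace (EuclideanSpace ℝ (Fin d)) X]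
  [RiemannianBundle (fun x : X => TangentSpace (𝓡 d) x)] [IsManifold (𝓡 d) ∞ X]
  {F : Type*} [NormedAddCommGroup F] [NormedSpace ℂ F]
  {E : X → Type*} [TopologicalSpace (TotalSpace F E)] [∀ x, NormedAddCommGroup (E x)]
  [∀ x, InnerProductSpace ℂ (E x)] [FiberBundle F E] [VectorBundle ℂ F E] [VectorBundle ℝ F E]
  {n : ZMod 8} (S : RealCliffordModule d F E n)

namespace RealCliffordModule

theorem J_op_J_op (s : Sections d F E) : S.J.op (S.J.op s) = koEps n • s :=
  Subtype.ext (funext fun x => S.J_sq x (s.1 x))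

/-- From `J² = ε` and `ε² = 1` one gets `J⁻¹ = ε J`. -/
theorem J_opStar_eq (s : Sections d F E) : S.J.opStar s = koEps n • S.J.op s := by
  rw [← S.J.opStar_op (koEps n • S.J.op s), map_zsmul, J_op_J_op, smul_smul, koEps_mul_self,
    one_smul]

/-- A real structure satisfies `J c(ξ) J* = ε' c(ξ)` for real covectors `ξ`. -/
theorem J_clifford_covector (x : X) (ξ : Cotangent d x) (v : E x) :
    S.J.toFun x (S.c.toFun x ξ ((S.J.toFun x).symm v)) = koEps' n • S.c.toFun x ξ v := by
  have hι : S.c.ext x (1 ⊗ₜ CliffordAlgebra.ι (cliffordForm (d := d) x) ξ) = S.c.toFun x ξ := by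
    refine (Algebra.TensorProduct.lift_tmul _ _ _ _ _).trans ?_
    rw [map_one, one_mul, CliffordAlgebra.lift_ι_apply]
  have h := S.J_clifford x (1 ⊗ₜ CliffordAlgebra.ι (cliffordForm (d := d) x) ξ) v
  have hs : cliffordStar x (1 ⊗ₜ CliffordAlgebra.ι (cliffordForm (d := d) x) ξ) =
      -(1 ⊗ₜ CliffordAlgebra.ι (cliffordForm (d := d) x) ξ) := by
    simp [cliffordStar, TensorProduct.tmul_neg]
  -- On a covector `reverse` is the identity and `involute` is `-1`, so the two branches of
  -- `cliffordTau` both give `-ε' ξ`.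
  have ht : cliffordTau (koEps' n) x (1 ⊗ₜ CliffordAlgebra.ι (cliffordForm (d := d) x) ξ) =
      -(koEps' n • (1 ⊗ₜ CliffordAlgebra.ι (cliffordForm (d := d) x) ξ)) := by
    rcases Int.isUnit_iff.1 (.of_mul_eq_one _ (koEps'_mul_self n)) with h | h <;>
      simp [cliffordTau, h, TensorProduct.tmul_neg]
  rw [hs, ht, map_neg, map_neg, map_zsmul, hι] at h
  simpa using h

theorem J_op_γ_op (h : Even n) (s : Sections d F E) :
    S.J.op ((S.γ h).op s) = koEps'' n • (S.γ h).op (S.J.op s) :=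
  Subtype.ext (funext fun x => S.J_γ h x (s.1 x))

theorem J_opStar_γ_op (h : Even n) (s : Sections d F E) :
    S.J.opStar ((S.γ h).op s) = koEps'' n • (S.γ h).op (S.J.opStar s) := by
  rw [J_opStar_eq, J_opStar_eq, J_op_γ_op, map_zsmul, smul_comm]

/-- The part `½ (D - ε' J D J*)` of an operator `D`. -/
def antiPart (D : Module.End ℂ (Sections d F E)) : Module.End ℂ (Sections d F E) :=
  (1 / 2 : ℂ) • (D - koEps' n • S.J.conj D)

theorem antiPart_apply (D : Module.End ℂ (Sections d F E)) (s : Sections d F E) :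
    S.antiPart D s = (1 / 2 : ℂ) • (D s - koEps' n • S.J.op (D (S.J.opStar s))) :=
  rfl

theorem antiPart_J_op (D : Module.End ℂ (Sections d F E)) (s : Sections d F E) :
    S.antiPart D (S.J.op s) = (1 / 2 : ℂ) • (D (S.J.op s) - koEps' n • S.J.op (D s)) := by
  rw [antiPart_apply, S.J.opStar_op]

theorem J_op_antiPart (D : Module.End ℂ (Sections d F E)) (s : Sections d F E) :
    S.J.op (S.antiPart D s) = (1 / 2 : ℂ) • (S.J.op (D s) - koEps' n • D (S.J.op s)) := by
  rw [antiPart_apply, LinearMap.map_smulₛₗ, map_sub, map_zsmul, J_op_J_op, J_opStar_eq, map_zsmul,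
    smul_smul (koEps n), koEps_mul_self, one_smul]
  have h2 : (starRingEnd ℂ) 2 = 2 := map_ofNat _ 2
  simp [h2]

/-- The part `½ (D - ε' J D J*)` satisfies `M J = -ε' J M`. -/
theorem antiPart_J_op_eq_neg (D : Module.End ℂ (Sections d F E)) (s : Sections d F E) :
    S.antiPart D (S.J.op s) = -(koEps' n • S.J.op (S.antiPart D s)) := by
  rw [antiPart_J_op, J_op_antiPart]
  rcases Int.isUnit_iff.1 (.of_mul_eq_one _ (koEps'_mul_self n)) with h | h <;> rw [h] <;> module

theorem isJCompatible_sub_antiPart (D : Module.End ℂ (Sections d F E)) :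
    IsJCompatible S (D - S.antiPart D) := by
  intro s
  rw [LinearMap.sub_apply, LinearMap.sub_apply, map_sub, antiPart_J_op, J_op_antiPart]
  rcases Int.isUnit_iff.1 (.of_mul_eq_one _ (koEps'_mul_self n)) with h | h <;> rw [h] <;> module

/-- If `D - M` is `J`-compatible and `M J = -ε' J M`, then `M = ½ (D - ε' J D J*)`. -/
theorem op_eq_antiPart {D : Module.End ℂ (Sections d F E)} {M : BundleEnd d F E}
    (hDM : IsJCompatible S (D - M.op)) (hM : JAnticommutes S M) : M.op = S.antiPart D := by
  ext1 s
  -- With `s = J t`, the two hypotheses combine to `D J t - ε' J D t = 2 M J t`.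
  obtain ⟨t, rfl⟩ : ∃ t, S.J.op t = s := ⟨_, S.J.op_opStar s⟩
  have h₁ := hDM t
  have h₂ : M.op (S.J.op t) = -(koEps' n • S.J.op (M.op t)) :=
    Subtype.ext (funext fun x => hM x (t.1 x))
  rw [LinearMap.sub_apply, LinearMap.sub_apply, map_sub, smul_sub] at h₁
  rw [antiPart_J_op, (eq_add_of_sub_eq h₁ : D (S.J.op t) = _), h₂]
  module

/-- If `[D, f] = c(df)` for all `f`, then `½ (D - ε' J D J*)` commutes with all functions. -/
theorem antiPart_mulFn {D : Module.End ℂ (Sections d F E)}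
    (hD : ∀ (f : C^∞⟮𝓡 d, X; 𝓘(ℝ, ℝ), ℝ⟯) (s : Sections d F E) (x : X),
      (⁅D, mulFn F E f⁆ s).1 x = S.c.toFun x (mvfderiv (𝓡 d) f x) (s.1 x))
    (f : C^∞⟮𝓡 d, X; 𝓘(ℝ, ℝ), ℝ⟯) (s : Sections d F E) :
    S.antiPart D (mulFn F E f s) = mulFn F E f (S.antiPart D s) := by
  have hf (s : Sections d F E) (x : X) : (D (mulFn F E f s)).1 x =
      f x • (D s).1 x + S.c.toFun x (mvfderiv (𝓡 d) f x) (s.1 x) := by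
    rw [← hD f s x, Ring.lie_def]
    exact (add_sub_cancel _ _).symm
  refine Subtype.ext (funext fun x => ?_)
  rw [antiPart_apply, antiPart_apply, S.J.opStar_mulFn]
  change (1 / 2 : ℂ) • ((D (mulFn F E f s)).1 x -
      koEps' n • S.J.toFun x ((D (mulFn F E f (S.J.opStar s))).1 x)) =
    f x • (1 / 2 : ℂ) • ((D s).1 x - koEps' n • S.J.toFun x ((D (S.J.opStar s)).1 x))
  have hJ : S.J.toFun x (S.c.toFun x (mvfderiv (𝓡 d) f x) ((S.J.opStar s).1 x)) =
      koEps' n • S.c.toFun x (mvfderiv (𝓡 d) f x) (s.1 x) := S.J_clifford_covector x _ _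
  -- The Clifford term of `ε' J D J*` carries `ε'² = 1`, so it cancels the one of `D`.
  rw [hf, hf, map_add, S.J.map_real_smul, hJ, smul_add, smul_smul, koEps'_mul_self, one_smul,
    add_sub_add_right_eq_sub, smul_comm (f x), smul_sub (f x), smul_comm (f x) (koEps' n)]

theorem antiPart_γ_op {D : Module.End ℂ (Sections d F E)} {h : Even n}
    (hD : ∀ s, D ((S.γ h).op s) = -(S.γ h).op (D s)) (s : Sections d F E) :
    S.antiPart D ((S.γ h).op s) = -(S.γ h).op (S.antiPart D s) := by
  rw [antiPart_apply, antiPart_apply, J_opStar_γ_op, map_zsmul, hD s, hD (S.J.opStar s), map_zsmul, map_neg, J_op_γ_op,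
    smul_neg (koEps'' n), smul_smul (koEps'' n), koEps''_mul_self, one_smul, map_smul, map_sub,
    map_zsmul]
  module

end RealCliffordModule

/-! ### Symmetry of the anticommuting part and perturbation of Dirac-type operators. -/

section Compact

variable [CompactSpace X] [T2Space X] [MeasurableSpace X] [BorelSpace X]
  [IsContMDiffRiemannianBundle (𝓡 d) ∞ (EuclideanSpace ℝ (Fin d))
      (fun x : X => TangentSpace (𝓡 d) x)]
  [IsSmoothHermitian d F E]

theorem RealCliffordModule.isL2Symmetric_antiPart {D : Module.End ℂ (Sections d F E)}
    (hD : IsL2Symmetric D) : IsL2Symmetric (S.antiPart D) := by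
  have h := (hD.sub ((hD.conj S.J fun s => S.J.conj_apply D s).smul (koEps' n : ℤ))).smul (1 / 2)
  have hε : (((koEps' n : ℤ) : ℝ) : ℂ) • S.J.conj D = koEps' n • S.J.conj D := by
    rw [Complex.ofReal_intCast]
    ext1 s
    exact Int.cast_smul_eq_zsmul ℂ (koEps' n) (S.J.conj D s)
  rw [hε] at h
  simpa [antiPart] using h

/-- Subtracting a symmetric odd bundle endomorphism from a Dirac-type operator gives a Dirac-type
operator. -/
theorem IsDiracType.sub_op {S : RealCliffordModule d F E n} {D : Module.End ℂ (Sections d F E)}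
    (hD : IsDiracType S D) {M : BundleEnd d F E} (hM : M.IsSymmetric)
    (hMγ : ∀ h s, M.op ((S.γ h).op s) = -(S.γ h).op (M.op s)) : IsDiracType S (D - M.op) := by
  -- A bundle endomorphism commutes with functions, so first order and the commutator `c(df)` are
  -- inherited from `D`.
  have hf (f : C^∞⟮𝓡 d, X; 𝓘(ℝ, ℝ), ℝ⟯) : ⁅D - M.op, mulFn F E f⁆ = ⁅D, mulFn F E f⁆ := by
    ext s x
    have hM : M.toFun x (f x • s.1 x) = f x • M.toFun x (s.1 x) := by
      rw [← Complex.coe_smul, map_smul, Complex.coe_smul]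
    change (D (mulFn F E f s)).1 x - M.toFun x (f x • s.1 x) -
        f x • ((D s).1 x - M.toFun x (s.1 x)) = (D (mulFn F E f s)).1 x - f x • (D s).1 x
    rw [hM, smul_sub]
    abel
  refine ⟨fun f g => ?_, fun f s x => ?_, hD.symmetric.sub hM.isL2Symmetric, fun h s => ?_⟩
  · rw [hf]
    exact hD.firstOrder f g
  · rw [hf]
    exact hD.commutator f s x
  · rw [LinearMap.sub_apply, LinearMap.sub_apply, hD.odd, hMγ, map_sub]
    abel

end Compact

end Dirac

end DiracReal

end

theorem mainTheorem5 {d : ℕ} {X : Type*} [TopologicalSpace X]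
    [ChartedSpace (EuclideanSpace ℝ (Fin d)) X] [IsManifold (𝓡 d) ∞ X]
    [CompactSpace X] [T2Space X] [MeasurableSpace X] [BorelSpace X]
    [RiemannianBundle (fun x : X => TangentSpace (𝓡 d) x)]
    [IsContMDiffRiemannianBundle (𝓡 d) ∞ (EuclideanSpace ℝ (Fin d))
      (fun x : X => TangentSpace (𝓡 d) x)]
    {F : Type*} [NormedAddCommGroup F] [NormedSpace ℂ F] [FiniteDimensional ℂ F]
    {E : X → Type*} [TopologicalSpace (TotalSpace F E)] [∀ x, NormedAddCommGroup (E x)]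
    [∀ x, InnerProductSpace ℂ (E x)] [FiberBundle F E] [VectorBundle ℂ F E] [VectorBundle ℝ F E]
    [ContMDiffVectorBundle ∞ F E (𝓡 d)] [IsSmoothHermitian d F E]
    (n : ZMod 8) (S : RealCliffordModule d F E n)
    (D : Module.End ℂ (Sections d F E)) (hD : IsDiracType S D) :
    (∃! M : BundleEnd d F E, M.IsSymmetric ∧ IsDiracType S (D - M.op) ∧
      IsJCompatible S (D - M.op) ∧ JAnticommutes S M) ∧
    (∀ M : BundleEnd d F E, M.IsSymmetric → IsJCompatible S (D - M.op) → JAnticommutes S M →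
      ∀ s : Sections d F E,
        M.op s = (1 / 2 : ℂ) • (D s - koEps' n • S.J.op (D (S.J.opStar s)))) := by
  refine ⟨?_, fun M _ hDM hM s => by rw [S.op_eq_antiPart hDM hM, S.antiPart_apply]⟩
  obtain ⟨M, hM⟩ := exists_bundleEnd_op_eq (S.antiPart_mulFn hD.commutator)
  have hMs : M.IsSymmetric :=
    BundleEnd.isSymmetric_of_isL2Symmetric (hM ▸ S.isL2Symmetric_antiPart hD.symmetric)
  refine ⟨M, ⟨hMs, hD.sub_op hMs fun h s => ?_, ?_, fun x v => ?_⟩, ?_⟩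
  · rw [hM]
    exact S.antiPart_γ_op (hD.odd h) s
  · rw [hM]
    exact S.isJCompatible_sub_antiPart D
  -- The relation holds on sections; a section through `v` gives it in the fibre.
  · obtain ⟨s, rfl⟩ := exists_section_eq (d := d) (F := F) (E := E) x v
    have h := S.antiPart_J_op_eq_neg D s
    rw [← hM] at h
    exact congrArg (fun t : Sections d F E => t.1 x) h
  · rintro N ⟨-, -, hDN, hN⟩
    exact BundleEnd.op_injective ((S.op_eq_antiPart hDN hN).trans hM.symm)
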